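/- Let $p \ge q \ge 2$ be integers and let $a, b \in \mathbb{C}$. Regard $$F : \mathbb{C}^2 \to \mathbb{C}, \qquad F(z,w) = z^p + w^q + a\bar z + b\bar w,$$ as a smooth map $\mathbb{R}^4 \to \mathbb{R}^2$. Suppose that $F$ is an excellent map, i.e. for each point $x$ of the source there are smooth local coordinates $(x_1,x_2,x_3,x_4)$ centered at $x$ and smooth local coordinates of the target centered at $F(x)$ in which $F$ has one of the forms 1. $(x_1,x_2,x_3,x_4) \mapsto (x_1, x_2)$ (regular point), 2. $(x_1,x_2,x_3,x_4) \mapsto (x_1, x_2^2+x_3^2+x_4^2)$ (definite fold), 3. $(x_1,x_2,x_3,x_4) \mapsto (x_1, x_2^2+x_3^2-x_4^2)$ (indefinite fold), 4. $(x_1,x_2,x_3,x_4) \mapsto (x_1, x_2^2\pm x_3^2+x_1x_4+x_4^3)$ (cusp). Then the set of cusps of $F$ (the points of $\mathbb{C}^2$ of type 4) is finite, and its number of elements belongs to $[(p+1)(q-1),\,(p-1)(q+1)]$. In particular, if $p = q$, then the number of cusps is exactly $p^2-1$. -/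

import Mathlib

open scoped ContDiff

/-- `φ` is a smooth (`C^∞`) system of local coordinates on the real normed space `E`,
centered at the point `x`: a diffeomorphism from an open neighbourhood of `x` onto an
open subset of `ℝⁿ` sending `x` to the origin. -/
structure IsLocalCoordinates {E : Type*} [NormedAddCommGroup E] [NormedSpace ℝ E] {n : ℕ}
    (φ : OpenPartialHomeomorph E (Fin n → ℝ)) (x : E) : Prop where
  mem_source : x ∈ φ.source
  map_eq_zero : φ x = 0
  contDiffOn : ContDiffOn ℝ ∞ φ φ.source
  contDiffOn_symm : ContDiffOn ℝ ∞ φ.symm φ.target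

/-- In suitable smooth local coordinates centered at `x` and at `f x`, the map `f` is
given by `N : ℝᵐ → ℝⁿ`. -/
def HasLocalForm {E F : Type*} [NormedAddCommGroup E] [NormedSpace ℝ E]
    [NormedAddCommGroup F] [NormedSpace ℝ F] {m n : ℕ}
    (f : E → F) (x : E) (N : (Fin m → ℝ) → (Fin n → ℝ)) : Prop :=
  ∃ (φ : OpenPartialHomeomorph E (Fin m → ℝ)) (ψ : OpenPartialHomeomorph F (Fin n → ℝ)),
    IsLocalCoordinates φ x ∧ IsLocalCoordinates ψ (f x) ∧
    Set.MapsTo f φ.source ψ.source ∧ ∀ y ∈ φ.source, ψ (f y) = N (φ y)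

section SingularityTypes

variable {E F : Type*} [NormedAddCommGroup E] [NormedSpace ℝ E]
  [NormedAddCommGroup F] [NormedSpace ℝ F]

/-- Normal form `(x₁, x₂, x₃, x₄) ↦ (x₁, x₂)`. -/
def IsRegularPoint (f : E → F) (x : E) : Prop :=
  HasLocalForm f x (fun v : Fin 4 → ℝ => ![v 0, v 1])

/-- Normal form `(x₁, x₂, x₃, x₄) ↦ (x₁, x₂² + x₃² + x₄²)`. -/
def IsDefiniteFold (f : E → F) (x : E) : Prop :=
  HasLocalForm f x (fun v : Fin 4 → ℝ => ![v 0, v 1 ^ 2 + v 2 ^ 2 + v 3 ^ 2])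

/-- Normal form `(x₁, x₂, x₃, x₄) ↦ (x₁, x₂² + x₃² - x₄²)`. -/
def IsIndefiniteFold (f : E → F) (x : E) : Prop :=
  HasLocalForm f x (fun v : Fin 4 → ℝ => ![v 0, v 1 ^ 2 + v 2 ^ 2 - v 3 ^ 2])

/-- Normal form `(x₁, x₂, x₃, x₄) ↦ (x₁, x₂² ± x₃² + x₁ x₄ + x₄³)`. -/
def IsCuspPoint (f : E → F) (x : E) : Prop :=
  HasLocalForm f x (fun v : Fin 4 → ℝ =>
    ![v 0, v 1 ^ 2 + v 2 ^ 2 + v 0 * v 3 + v 3 ^ 3]) ∨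
  HasLocalForm f x (fun v : Fin 4 → ℝ =>
    ![v 0, v 1 ^ 2 - v 2 ^ 2 + v 0 * v 3 + v 3 ^ 3])

/-- A smooth map from a real 4-dimensional space to a real 2-dimensional one is excellent
if every point is a regular point, a definite fold, an indefinite fold or a cusp. -/
def IsExcellentMap (f : E → F) : Prop :=
  ContDiff ℝ ∞ f ∧
    ∀ x : E, IsRegularPoint f x ∨ IsDefiniteFold f x ∨ IsIndefiniteFold f x ∨ IsCuspPoint f x

/-- The set of cusps of `f`, in the source. -/
def cuspSet (f : E → F) : Set E := {x | IsCuspPoint f x}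

end SingularityTypes

/-- The map `(z, w) ↦ z^p + w^q + a z̄ + b w̄` from `ℂ²` to `ℂ`. -/
def deformedBrieskorn (p q : ℕ) (a b : ℂ) (x : ℂ × ℂ) : ℂ :=
  x.1 ^ p + x.2 ^ q + a * (starRingEnd ℂ) x.1 + b * (starRingEnd ℂ) x.2

/-! The cusps of an excellent map are its degenerate critical points: some codirection `l ≠ 0` kills
the image of the differential, and the Hessian paired with `l` degenerates on the kernel. This is
invariant under coordinate changes, so the normal forms show that it characterizes cusps, that such
points are isolated, and that the differential never vanishes
(`IsExcellentMap.fderiv_ne_zero_and_isCuspPoint_iff`, `IsExcellentMap.eventually_eq`).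

For `F`, write the codirection as `Re (ᾱ ·)` with `|α| = 1`. Criticality becomes `p z^(p-1) = -α²
ā`, `q w^(q-1) = -α² b̄`. Degeneracy becomes `Re α(ā z/(p-1) + b̄ w/(q-1)) = 0`, by a criterion for
a diagonal quadratic form on a real hyperplane (`exists_degenerate_iff`).

With a solution `(z₀, w₀)` for `α = 1` fixed, the critical set is parametrized by `|x| = 1` and
`ζ^(q-1) = 1` through `critParam`, where `α = x^((p-1)(q-1))`. On the branch of `ζ` the cusp
equation is `Re (A x^m + B x^n) = 0` with `m = (p+1)(q-1) ≤ n = (q+1)(p-1)`. It has at least `2m`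
zeros (`le_encard_trigZeros`) and, since isolation of cusps prevents it from vanishing identically,
at most `2n` (`trigZeros_upper`). There are `q-1` branches and each cusp has `2(q-1)` parameters, so
the number of cusps lies between `m` and `n`. -/

open ComplexConjugate

/-! ### Degenerate critical points and their invariance under coordinate changes. -/

section DegenerateCritical

variable {E E' F F' : Type*} [NormedAddCommGroup E] [NormedSpace ℝ E]
  [NormedAddCommGroup E'] [NormedSpace ℝ E']
  [NormedAddCommGroup F] [NormedSpace ℝ F] [NormedAddCommGroup F'] [NormedSpace ℝ F']

/-- `x` is a critical point of `f` at which the second intrinsic derivative (the Hessian on the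
kernel of the differential, with values in the cokernel) is degenerate in some codirection. -/
def IsDegenerateCritical (f : E → F) (x : E) : Prop :=
  ∃ l : F →L[ℝ] ℝ, l ≠ 0 ∧ (∀ k, l (fderiv ℝ f x k) = 0) ∧
    ∃ h, h ≠ 0 ∧ fderiv ℝ f x h = 0 ∧
      ∀ k, fderiv ℝ f x k = 0 → l (fderiv ℝ (fderiv ℝ f) x h k) = 0

theorem IsDegenerateCritical.congr {f g : E → F} {x : E} (h : f =ᶠ[nhds x] g) :
    IsDegenerateCritical f x ↔ IsDegenerateCritical g x := by
  simp only [IsDegenerateCritical, h.fderiv_eq, h.fderiv.fderiv_eq]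

theorem fderiv_fderiv_comp {f : E' → F} {g : E → E'} {x : E} (hf : ContDiffAt ℝ 2 f (g x))
    (hg : ContDiffAt ℝ 2 g x) (h k : E) :
    fderiv ℝ (fderiv ℝ (f ∘ g)) x h k =
      fderiv ℝ (fderiv ℝ f) (g x) (fderiv ℝ g x h) (fderiv ℝ g x k) +
        fderiv ℝ f (g x) (fderiv ℝ (fderiv ℝ g) x h k) := by
  have hg1 : DifferentiableAt ℝ g x := hg.differentiableAt (by norm_num)
  have hg2 : DifferentiableAt ℝ (fderiv ℝ g) x :=
    (hg.fderiv_right (m := 1) (by norm_num)).differentiableAt (by norm_num)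
  have hf2 : DifferentiableAt ℝ (fderiv ℝ f) (g x) :=
    (hf.fderiv_right (m := 1) (by norm_num)).differentiableAt (by norm_num)
  have hev : fderiv ℝ (f ∘ g) =ᶠ[nhds x] fun y => (fderiv ℝ f (g y)).comp (fderiv ℝ g y) := by
    have h1 : ∀ᶠ y in nhds x, ContDiffAt ℝ 2 g y := hg.eventually (by simp)
    have h2 : ∀ᶠ y in nhds x, ContDiffAt ℝ 2 f (g y) :=
      hg.continuousAt.eventually (hf.eventually (by simp))
    filter_upwards [h1, h2] with y hy1 hy2
    exact fderiv_comp y (hy2.differentiableAt (by norm_num)) (hy1.differentiableAt (by norm_num))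
  rw [hev.fderiv_eq]
  have := ((hf2.hasFDerivAt.comp x hg1.hasFDerivAt).clm_comp hg2.hasFDerivAt).fderiv
  simp only [Function.comp_def] at this
  rw [this]
  simp [add_comm]

/-- The extra term `f'(g''(h, k))` of the second-order chain rule lies in the image of `f'`, which
`l` kills. -/
theorem isDegenerateCritical_comp_right {f : E' → F} {g : E → E'} {x : E}
    (hf : ContDiffAt ℝ 2 f (g x)) (hg : ContDiffAt ℝ 2 g x) (e : E ≃L[ℝ] E')
    (he : fderiv ℝ g x = e) :
    IsDegenerateCritical (f ∘ g) x ↔ IsDegenerateCritical f (g x) := by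
  have h1 : fderiv ℝ (f ∘ g) x = (fderiv ℝ f (g x)).comp (e : E →L[ℝ] E') := by
    rw [← he]
    exact fderiv_comp x (hf.differentiableAt (by norm_num)) (hg.differentiableAt (by norm_num))
  simp only [IsDegenerateCritical, fderiv_fderiv_comp hf hg, h1, he]
  simp only [ContinuousLinearMap.comp_apply, ContinuousLinearEquiv.coe_coe, map_add]
  refine exists_congr fun l => and_congr_right fun _ => ?_
  constructor
  · rintro ⟨hl, h, h0, hh, hk⟩
    have hl' : ∀ k, l (fderiv ℝ f (g x) k) = 0 := fun k => by simpa using hl (e.symm k)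
    refine ⟨hl', e h, by simpa using h0, hh, fun k hk' => ?_⟩
    simpa [hl'] using hk (e.symm k) (by simpa using hk')
  · rintro ⟨hl, h, h0, hh, hk⟩
    refine ⟨fun k => hl _, e.symm h, by simpa using h0, by simpa using hh, fun k hk' => ?_⟩
    simpa [hl] using hk (e k) hk'

/-- Here the extra term is `g''(f' h, f' k)`, which vanishes because `h` is in the kernel of `f'`.
-/
theorem isDegenerateCritical_comp_left {f : E → F} {g : F → F'} {x : E}
    (hg : ContDiffAt ℝ 2 g (f x)) (hf : ContDiffAt ℝ 2 f x) (e : F ≃L[ℝ] F')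
    (he : fderiv ℝ g (f x) = e) :
    IsDegenerateCritical (g ∘ f) x ↔ IsDegenerateCritical f x := by
  have h1 : fderiv ℝ (g ∘ f) x = (e : F →L[ℝ] F').comp (fderiv ℝ f x) := by
    rw [← he]
    exact fderiv_comp x (hg.differentiableAt (by norm_num)) (hf.differentiableAt (by norm_num))
  simp only [IsDegenerateCritical, fderiv_fderiv_comp hg hf, h1, he]
  simp only [ContinuousLinearMap.comp_apply, ContinuousLinearEquiv.coe_coe, map_add,
    EmbeddingLike.map_eq_zero_iff]
  constructor
  · rintro ⟨l, l0, hl, h, h0, hh, hk⟩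
    refine ⟨l.comp (e : F →L[ℝ] F'), fun h' => l0 ?_, hl, h, h0, hh, fun k hk' => ?_⟩
    · ext y
      simpa using DFunLike.congr_fun h' (e.symm y)
    · simpa [hh] using hk k hk'
  · rintro ⟨l, l0, hl, h, h0, hh, hk⟩
    refine ⟨l.comp (e.symm : F' →L[ℝ] F), fun h' => l0 ?_, by simpa using hl, h, h0, hh,
      fun k hk' => ?_⟩
    · ext y
      simpa using DFunLike.congr_fun h' (e y)
    · simpa [hh] using hk k hk'

theorem OpenPartialHomeomorph.exists_fderiv_eq_equiv (φ : OpenPartialHomeomorph E E')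
    (h1 : ContDiffOn ℝ ∞ φ φ.source) (h2 : ContDiffOn ℝ ∞ φ.symm φ.target) {y : E}
    (hy : y ∈ φ.source) : ContDiffAt ℝ 2 φ y ∧ ∃ e : E ≃L[ℝ] E', fderiv ℝ φ y = e := by
  have c1 : ContDiffAt ℝ ∞ φ y := h1.contDiffAt (φ.open_source.mem_nhds hy)
  have c2 : ContDiffAt ℝ ∞ φ.symm (φ y) :=
    h2.contDiffAt (φ.open_target.mem_nhds (φ.map_source hy))
  have d1 := (c1.differentiableAt (by simp)).hasFDerivAt
  have d2 := (c2.differentiableAt (by simp)).hasFDerivAt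
  have e1 := (d2.comp y d1).congr_of_eventuallyEq (f₁ := id)
    (by filter_upwards [φ.eventually_left_inverse hy] with z hz using hz.symm)
  have d1' := d1
  rw [← φ.left_inv hy] at d1'
  have e2 := (d1'.comp (φ y) d2).congr_of_eventuallyEq (f₁ := id)
    (by filter_upwards [φ.eventually_right_inverse (φ.map_source hy)] with z hz using hz.symm)
  have i1 := e1.unique (hasFDerivAt_id y)
  have i2 := e2.unique (hasFDerivAt_id (φ y))
  rw [φ.left_inv hy] at i2
  exact ⟨mod_cast contDiffAt_infty.1 c1 2, ContinuousLinearEquiv.equivOfInverse _ _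
    (fun v => DFunLike.congr_fun i1 v) (fun v => DFunLike.congr_fun i2 v), rfl⟩

variable {m n : ℕ} {f : E → F} {x : E} {N : (Fin m → ℝ) → (Fin n → ℝ)}

/-- Working at every `y` of the chart, not only at its centre, is what later gives isolation of
cusps. -/
theorem isDegenerateCritical_iff_of_localForm {φ : OpenPartialHomeomorph E (Fin m → ℝ)}
    {ψ : OpenPartialHomeomorph F (Fin n → ℝ)} (hf : ContDiff ℝ ∞ f) (hN : ContDiff ℝ ∞ N)
    (hφ : IsLocalCoordinates φ x) (hψ : IsLocalCoordinates ψ (f x))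
    (hm : Set.MapsTo f φ.source ψ.source) (hfN : ∀ y ∈ φ.source, ψ (f y) = N (φ y))
    {y : E} (hy : y ∈ φ.source) :
    (IsDegenerateCritical f y ↔ IsDegenerateCritical N (φ y)) ∧
      (fderiv ℝ f y = 0 → fderiv ℝ N (φ y) = 0) := by
  obtain ⟨c1, e1, he1⟩ := φ.exists_fderiv_eq_equiv hφ.contDiffOn hφ.contDiffOn_symm hy
  obtain ⟨c2, e2, he2⟩ := ψ.exists_fderiv_eq_equiv hψ.contDiffOn hψ.contDiffOn_symm (hm hy)
  have hf' : ContDiffAt ℝ 2 f y := mod_cast contDiffAt_infty.1 hf.contDiffAt 2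
  have hN' : ContDiffAt ℝ 2 N (φ y) := mod_cast contDiffAt_infty.1 hN.contDiffAt 2
  have hev : ψ ∘ f =ᶠ[nhds y] N ∘ φ := by
    filter_upwards [φ.open_source.mem_nhds hy] with z hz using hfN z hz
  refine ⟨?_, fun h0 => ?_⟩
  · rw [← isDegenerateCritical_comp_left c2 hf' e2 he2, IsDegenerateCritical.congr hev,
      isDegenerateCritical_comp_right hN' c1 e1 he1]
  · have := hev.fderiv_eq (𝕜 := ℝ)
    rw [fderiv_comp y (c2.differentiableAt (by norm_num)) (hf'.differentiableAt (by norm_num)),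
      fderiv_comp y (hN'.differentiableAt (by norm_num)) (c1.differentiableAt (by norm_num)),
      h0, he1] at this
    ext1 v
    have := DFunLike.congr_fun this (e1.symm v)
    simpa using this.symm

end DegenerateCritical

/-! ### Derivatives of the maps `(v₀, g)` and of the normal forms. -/

theorem fderiv_fderiv_apply {E F : Type*} [NormedAddCommGroup E] [NormedSpace ℝ E]
    [NormedAddCommGroup F] [NormedSpace ℝ F] {f : E → F} (hf : ContDiff ℝ ∞ f) (x h k : E) :
    fderiv ℝ (fderiv ℝ f) x h k = fderiv ℝ (fun y => fderiv ℝ f y k) x h := by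
  have hd : DifferentiableAt ℝ (fderiv ℝ f) x :=
    (hf.fderiv_right (m := 1) (by norm_cast)).differentiable (by norm_num) x
  rw [(hd.hasFDerivAt.clm_apply (hasFDerivAt_const k x)).fderiv]
  simp

section Graph

variable {g : (Fin 4 → ℝ) → ℝ}

theorem contDiff_graph (hg : ContDiff ℝ ∞ g) :
    ContDiff ℝ ∞ (fun v : Fin 4 → ℝ => ![v 0, g v]) := by
  refine contDiff_pi.2 fun i => ?_
  fin_cases i
  · exact contDiff_apply ℝ ℝ 0
  · exact hg

theorem fderiv_graph (hg : ContDiff ℝ ∞ g) (v k : Fin 4 → ℝ) :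
    fderiv ℝ (fun v : Fin 4 → ℝ => ![v 0, g v]) v k = ![k 0, fderiv ℝ g v k] := by
  have : HasFDerivAt (fun v : Fin 4 → ℝ => ![v 0, g v]) (ContinuousLinearMap.pi
      ![ContinuousLinearMap.proj (R := ℝ) (φ := fun _ : Fin 4 => ℝ) 0, fderiv ℝ g v]) v := by
    refine hasFDerivAt_pi.2 fun i => ?_
    fin_cases i
    · exact hasFDerivAt_apply 0 v
    · exact (hg.differentiable (by simp) v).hasFDerivAt
  rw [this.fderiv]
  ext i
  fin_cases i <;> simp

theorem fderiv_fderiv_graph (hg : ContDiff ℝ ∞ g) (v h k : Fin 4 → ℝ) :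
    fderiv ℝ (fderiv ℝ (fun v : Fin 4 → ℝ => ![v 0, g v])) v h k =
      ![0, fderiv ℝ (fderiv ℝ g) v h k] := by
  rw [fderiv_fderiv_apply (contDiff_graph hg), fderiv_fderiv_apply hg]
  simp only [fderiv_graph hg]
  have hd : DifferentiableAt ℝ (fun y => fderiv ℝ g y k) v :=
    ((hg.fderiv_right (m := 1) (by norm_cast)).clm_apply contDiff_const).differentiable
      (by norm_num) v
  have : HasFDerivAt (fun v : Fin 4 → ℝ => ![k 0, fderiv ℝ g v k]) (ContinuousLinearMap.pi
      ![0, fderiv ℝ (fun y => fderiv ℝ g y k) v]) v := by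
    refine hasFDerivAt_pi.2 fun i => ?_
    fin_cases i
    · exact hasFDerivAt_const _ _
    · exact hd.hasFDerivAt
  rw [this.fderiv]
  ext i
  fin_cases i <;> simp

/-- The first component is a linear submersion: it forces `l` to be nonzero on the second axis, adds
nothing to the Hessian, and makes `k 0 = 0` the kernel at a critical point. -/
theorem isDegenerateCritical_graph_iff (hg : ContDiff ℝ ∞ g) (v : Fin 4 → ℝ) :
    IsDegenerateCritical (fun v : Fin 4 → ℝ => ![v 0, g v]) v ↔
      (∀ k, k 0 = 0 → fderiv ℝ g v k = 0) ∧ ∃ h, h ≠ 0 ∧ h 0 = 0 ∧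
        ∀ k, k 0 = 0 → fderiv ℝ (fderiv ℝ g) v h k = 0 := by
  simp only [IsDegenerateCritical, fderiv_graph hg, fderiv_fderiv_graph hg]
  have hvec (s t : ℝ) : ![s, t] = 0 ↔ s = 0 ∧ t = 0 := by
    simp [funext_iff, Fin.forall_fin_two]
  constructor
  · rintro ⟨l, l0, hl, h, h0, hh, hk⟩
    have key (s t : ℝ) : l ![s, t] = s * l ![1, 0] + t * l ![0, 1] := by
      rw [← smul_eq_mul, ← smul_eq_mul, ← map_smul, ← map_smul, ← map_add]
      congr 1
      ext i
      fin_cases i <;> simp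
    have l1 : l ![0, 1] ≠ 0 := by
      intro h1
      have := hl (Pi.single 0 1)
      rw [key, h1] at this
      apply l0
      ext w
      have hw : w = ![w 0, w 1] := by ext i; fin_cases i <;> rfl
      have h2 : l ![1, 0] = 0 := by simpa using this
      rw [hw, key, h1, h2]
      simp
    have crit : ∀ k, k 0 = 0 → fderiv ℝ g v k = 0 := by
      intro k hk0
      have := hl k
      rw [key, hk0] at this
      simpa [l1] using this
    refine ⟨crit, h, h0, ((hvec _ _).1 hh).1, fun k hk0 => ?_⟩
    have := hk k (by rw [hvec]; exact ⟨hk0, crit k hk0⟩)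
    rw [key] at this
    simpa [l1] using this
  · rintro ⟨crit, h, h0, hh, hk⟩
    have hlin (k : Fin 4 → ℝ) : fderiv ℝ g v k = k 0 * fderiv ℝ g v (Pi.single 0 1) := by
      have := crit (k - k 0 • Pi.single 0 1) (by simp)
      simpa [sub_eq_zero] using this
    refine ⟨ContinuousLinearMap.proj (R := ℝ) (φ := fun _ : Fin 2 => ℝ) 1 -
      fderiv ℝ g v (Pi.single 0 1) • ContinuousLinearMap.proj (R := ℝ) (φ := fun _ : Fin 2 => ℝ) 0,
      fun h' => ?_, fun k => ?_, h, h0, by rw [hvec]; exact ⟨hh, crit h hh⟩, fun k hk' => ?_⟩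
    · simpa using DFunLike.congr_fun h' ![0, 1]
    · simp [hlin k, mul_comm]
    · simpa using hk k ((hvec _ _).1 hk').1

theorem fderiv_graph_ne_zero (hg : ContDiff ℝ ∞ g) (v : Fin 4 → ℝ) :
    fderiv ℝ (fun v : Fin 4 → ℝ => ![v 0, g v]) v ≠ 0 := by
  intro h
  have := congrFun ((fderiv_graph hg v (Pi.single 0 1)).symm.trans (by rw [h])) 0
  simp at this

end Graph

/-- The common shape of the second components of the normal forms. -/
def cuspComponent (c₁ c₂ c₃ c₄ c₅ c₆ : ℝ) (v : Fin 4 → ℝ) : ℝ :=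
  c₁ * v 1 + c₂ * v 1 ^ 2 + c₃ * v 2 ^ 2 + c₄ * v 3 ^ 2 + c₅ * (v 0 * v 3) + c₆ * v 3 ^ 3

theorem fderiv_cuspComponent (c₁ c₂ c₃ c₄ c₅ c₆ : ℝ) (v k : Fin 4 → ℝ) :
    fderiv ℝ (cuspComponent c₁ c₂ c₃ c₄ c₅ c₆) v k =
      (c₁ + 2 * c₂ * v 1) * k 1 + 2 * c₃ * v 2 * k 2 + (2 * c₄ * v 3 + c₅ * v 0 +
        3 * c₆ * v 3 ^ 2) * k 3 + c₅ * v 3 * k 0 := by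
  have p (i : Fin 4) : HasFDerivAt (fun v : Fin 4 → ℝ => v i)
      (ContinuousLinearMap.proj (R := ℝ) (φ := fun _ : Fin 4 => ℝ) i) v := hasFDerivAt_apply i v
  have := ((((((p 1).const_mul c₁).add (((p 1).pow 2).const_mul c₂)).add
    (((p 2).pow 2).const_mul c₃)).add (((p 3).pow 2).const_mul c₄)).add
    (((p 0).mul (p 3)).const_mul c₅)).add (((p 3).pow 3).const_mul c₆)
  rw [HasFDerivAt.fderiv (f := cuspComponent c₁ c₂ c₃ c₄ c₅ c₆) this]
  simp
  ring

theorem contDiff_cuspComponent (c₁ c₂ c₃ c₄ c₅ c₆ : ℝ) :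
    ContDiff ℝ ∞ (cuspComponent c₁ c₂ c₃ c₄ c₅ c₆) := by
  unfold cuspComponent; fun_prop

theorem fderiv_fderiv_cuspComponent (c₁ c₂ c₃ c₄ c₅ c₆ : ℝ) (v h k : Fin 4 → ℝ) :
    fderiv ℝ (fderiv ℝ (cuspComponent c₁ c₂ c₃ c₄ c₅ c₆)) v h k =
      2 * c₂ * h 1 * k 1 + 2 * c₃ * h 2 * k 2 + (2 * c₄ * h 3 + c₅ * h 0 +
        6 * c₆ * v 3 * h 3) * k 3 + c₅ * h 3 * k 0 := by
  rw [fderiv_fderiv_apply (contDiff_cuspComponent c₁ c₂ c₃ c₄ c₅ c₆)]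
  simp only [fderiv_cuspComponent]
  have p (i : Fin 4) : HasFDerivAt (fun v : Fin 4 → ℝ => v i)
      (ContinuousLinearMap.proj (R := ℝ) (φ := fun _ : Fin 4 => ℝ) i) v := hasFDerivAt_apply i v
  have := (((((p 1).const_mul (2 * c₂)).const_add c₁).mul_const (k 1)).add
    (((p 2).const_mul (2 * c₃)).mul_const (k 2))).add
    ((((((p 3).const_mul (2 * c₄)).add ((p 0).const_mul c₅)).add
      (((p 3).pow 2).const_mul (3 * c₆)))).mul_const (k 3)) |>.add
    (((p 3).const_mul c₅).mul_const (k 0))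
  refine (DFunLike.congr_fun (HasFDerivAt.fderiv this) h).trans ?_
  simp
  ring

/-! ### Cusps of excellent maps as isolated degenerate critical points. -/

section NormalForms

variable {E F : Type*} [NormedAddCommGroup E] [NormedSpace ℝ E]
  [NormedAddCommGroup F] [NormedSpace ℝ F] {f : E → F} {x : E}

theorem isDegenerateCritical_cuspComponent_iff (c₁ c₂ c₃ c₄ c₅ c₆ : ℝ) (v : Fin 4 → ℝ) :
    IsDegenerateCritical (fun v : Fin 4 → ℝ => ![v 0, cuspComponent c₁ c₂ c₃ c₄ c₅ c₆ v]) v ↔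
      (c₁ + 2 * c₂ * v 1 = 0 ∧ 2 * c₃ * v 2 = 0 ∧
        2 * c₄ * v 3 + c₅ * v 0 + 3 * c₆ * v 3 ^ 2 = 0) ∧
      (c₂ = 0 ∨ c₃ = 0 ∨ 2 * c₄ + 6 * c₆ * v 3 = 0) := by
  rw [isDegenerateCritical_graph_iff (contDiff_cuspComponent ..)]
  simp only [fderiv_cuspComponent, fderiv_fderiv_cuspComponent]
  refine and_congr ⟨fun h => ?_, fun ⟨h1, h2, h3⟩ k hk => by simp [h1, h2, h3, hk]⟩
    ⟨fun ⟨h, h0, hh, hk⟩ => ?_, ?_⟩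
  · exact ⟨by simpa using h (Pi.single 1 1) (by simp), by simpa using h (Pi.single 2 1) (by simp),
      by simpa using h (Pi.single 3 1) (by simp)⟩
  · have h1 := hk (Pi.single 1 1) (by simp)
    have h2 := hk (Pi.single 2 1) (by simp)
    have h3 := hk (Pi.single 3 1) (by simp)
    simp [hh] at h1 h2 h3
    by_contra! hc
    obtain ⟨hc2, hc3, hc4⟩ := hc
    apply h0
    ext i
    fin_cases i
    · exact hh
    · simpa [hc2] using h1
    · simpa [hc3] using h2
    · have : (2 * c₄ + 6 * c₆ * v 3) * h 3 = 0 := by linear_combination h3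
      simpa [hc4] using this
  · rintro (h | h | h)
    · exact ⟨Pi.single 1 1, by simp, by simp, fun k hk => by simp [h, hk]⟩
    · exact ⟨Pi.single 2 1, by simp, by simp, fun k hk => by simp [h, hk]⟩
    · exact ⟨Pi.single 3 1, by simp, by simp, fun k hk => by simp [h, hk]⟩

theorem HasLocalForm.isDegenerateCritical_iff {c₁ c₂ c₃ c₄ c₅ c₆ : ℝ} (hf : ContDiff ℝ ∞ f)
    (h : HasLocalForm f x (fun v : Fin 4 → ℝ => ![v 0, cuspComponent c₁ c₂ c₃ c₄ c₅ c₆ v])) :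
    fderiv ℝ f x ≠ 0 ∧
      (IsDegenerateCritical f x ↔ c₁ = 0 ∧ (c₂ = 0 ∨ c₃ = 0 ∨ c₄ = 0)) := by
  obtain ⟨φ, ψ, hφ, hψ, hm, hfN⟩ := h
  have := isDegenerateCritical_iff_of_localForm hf (contDiff_graph (contDiff_cuspComponent ..))
    hφ hψ hm hfN hφ.mem_source
  refine ⟨fun h0 => fderiv_graph_ne_zero (contDiff_cuspComponent ..) _ (this.2 h0), ?_⟩
  rw [this.1, isDegenerateCritical_cuspComponent_iff, hφ.map_eq_zero]
  simp

/-- In the cusp chart, degeneracy forces `6 v₃ = 0`; the critical equations then annihilate the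
other coordinates. -/
theorem HasLocalForm.eventually_eq_of_cusp {c₂ c₃ : ℝ} (hf : ContDiff ℝ ∞ f) (h2 : c₂ ≠ 0)
    (h3 : c₃ ≠ 0)
    (h : HasLocalForm f x (fun v : Fin 4 → ℝ => ![v 0, cuspComponent 0 c₂ c₃ 0 1 1 v])) :
    ∀ᶠ y in nhds x, IsDegenerateCritical f y → y = x := by
  obtain ⟨φ, ψ, hφ, hψ, hm, hfN⟩ := h
  filter_upwards [φ.open_source.mem_nhds hφ.mem_source] with y hy hD
  rw [(isDegenerateCritical_iff_of_localForm hf (contDiff_graph (contDiff_cuspComponent ..))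
    hφ hψ hm hfN hy).1, isDegenerateCritical_cuspComponent_iff] at hD
  obtain ⟨⟨e1, e2, e3⟩, e4⟩ := hD
  have e5 : φ y 3 = 0 := by simpa [h2, h3] using e4
  apply φ.injOn hy hφ.mem_source
  rw [hφ.map_eq_zero]
  ext i
  fin_cases i
  · simpa [e5] using e3
  · simpa [h2] using e1
  · simpa [h3] using e2
  · exact e5

theorem IsCuspPoint.exists_localForm (h : IsCuspPoint f x) : ∃ c : ℝ, c ≠ 0 ∧ HasLocalForm f x
    (fun v : Fin 4 → ℝ => ![v 0, cuspComponent 0 1 c 0 1 1 v]) := by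
  rcases h with h | h
  · exact ⟨1, one_ne_zero, by simpa [cuspComponent] using h⟩
  · exact ⟨-1, by norm_num, by simpa [cuspComponent, sub_eq_add_neg] using h⟩

theorem IsExcellentMap.fderiv_ne_zero_and_isCuspPoint_iff (hf : IsExcellentMap f) (x : E) :
    fderiv ℝ f x ≠ 0 ∧ (IsCuspPoint f x ↔ IsDegenerateCritical f x) := by
  have hC (h : IsCuspPoint f x) : fderiv ℝ f x ≠ 0 ∧ IsDegenerateCritical f x := by
    obtain ⟨c, hc, h⟩ := h.exists_localForm
    have := h.isDegenerateCritical_iff hf.1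
    exact ⟨this.1, this.2.2 (by simp)⟩
  have hN {c₁ c₂ c₃ c₄ : ℝ} (hc : ¬(c₁ = 0 ∧ (c₂ = 0 ∨ c₃ = 0 ∨ c₄ = 0)))
      (h : HasLocalForm f x (fun v : Fin 4 → ℝ => ![v 0, cuspComponent c₁ c₂ c₃ c₄ 0 0 v])) :
      fderiv ℝ f x ≠ 0 ∧ (IsCuspPoint f x ↔ IsDegenerateCritical f x) := by
    have := h.isDegenerateCritical_iff hf.1
    exact ⟨this.1, fun h' => (hC h').2, fun h' => absurd (this.2.1 h') hc⟩
  rcases hf.2 x with h | h | h | h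
  · exact hN (c₁ := 1) (c₂ := 0) (c₃ := 0) (c₄ := 0) (by simp)
      (by simpa [cuspComponent, IsRegularPoint] using h)
  · exact hN (c₁ := 0) (c₂ := 1) (c₃ := 1) (c₄ := 1) (by simp)
      (by simpa [cuspComponent, IsDefiniteFold] using h)
  · exact hN (c₁ := 0) (c₂ := 1) (c₃ := 1) (c₄ := -1) (by simp)
      (by simpa [cuspComponent, IsIndefiniteFold, sub_eq_add_neg] using h)
  · exact ⟨(hC h).1, fun h' => (hC h').2, fun _ => h⟩

theorem IsExcellentMap.eventually_eq (hf : IsExcellentMap f) (hx : IsDegenerateCritical f x) :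
    ∀ᶠ y in nhds x, IsDegenerateCritical f y → y = x := by
  obtain ⟨c, hc, h⟩ := ((hf.fderiv_ne_zero_and_isCuspPoint_iff x).2.2 hx).exists_localForm
  exact h.eventually_eq_of_cusp hf.1 one_ne_zero hc

end NormalForms

/-! ### Degenerate critical points of `z^p + w^q + a z̄ + b w̄`. -/

section DeformedBrieskorn

variable {p q : ℕ} {a b : ℂ}

theorem contDiff_deformedBrieskorn (p q : ℕ) (a b : ℂ) :
    ContDiff ℝ ∞ (deformedBrieskorn p q a b) := by
  have : ContDiff ℝ ∞ (starRingEnd ℂ) := Complex.conjCLE.contDiff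
  unfold deformedBrieskorn
  fun_prop

theorem fderiv_deformedBrieskorn (p q : ℕ) (a b : ℂ) (x h : ℂ × ℂ) :
    fderiv ℝ (deformedBrieskorn p q a b) x h =
      p * x.1 ^ (p - 1) * h.1 + q * x.2 ^ (q - 1) * h.2 + a * conj h.1 + b * conj h.2 := by
  have h1 : HasFDerivAt (fun x : ℂ × ℂ => x.1) (ContinuousLinearMap.fst ℝ ℂ ℂ) x := hasFDerivAt_fst
  have h2 : HasFDerivAt (fun x : ℂ × ℂ => x.2) (ContinuousLinearMap.snd ℝ ℂ ℂ) x := hasFDerivAt_snd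
  have c1 := (Complex.conjCLE.hasFDerivAt (x := x.1)).comp x h1
  have c2 := (Complex.conjCLE.hasFDerivAt (x := x.2)).comp x h2
  have := (((h1.pow p).add (h2.pow q)).add (c1.const_mul a)).add (c2.const_mul b)
  refine (DFunLike.congr_fun (HasFDerivAt.fderiv this) h).trans ?_
  simp

theorem fderiv_fderiv_deformedBrieskorn (p q : ℕ) (a b : ℂ) (x h k : ℂ × ℂ) :
    fderiv ℝ (fderiv ℝ (deformedBrieskorn p q a b)) x h k =
      p * (p - 1 : ℕ) * x.1 ^ (p - 2) * h.1 * k.1 + q * (q - 1 : ℕ) * x.2 ^ (q - 2) * h.2 * k.2 := by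
  rw [fderiv_fderiv_apply (contDiff_deformedBrieskorn p q a b)]
  simp only [fderiv_deformedBrieskorn]
  have h1 : HasFDerivAt (fun x : ℂ × ℂ => x.1) (ContinuousLinearMap.fst ℝ ℂ ℂ) x := hasFDerivAt_fst
  have h2 : HasFDerivAt (fun x : ℂ × ℂ => x.2) (ContinuousLinearMap.snd ℝ ℂ ℂ) x := hasFDerivAt_snd
  have := ((((((h1.pow (p - 1)).const_mul (p : ℂ)).mul_const k.1).add
    (((h2.pow (q - 1)).const_mul (q : ℂ)).mul_const k.2)).add_const (a * conj k.1)).add_const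
      (b * conj k.2))
  refine (DFunLike.congr_fun (HasFDerivAt.fderiv this) h).trans ?_
  simp [Nat.sub_sub]
  ring

/-- Nonzero real functionals on `ℂ` are the `Re (ᾱ ·)` up to positive scaling. -/
theorem exists_norm_eq_one_of_dual {l : ℂ →L[ℝ] ℝ} (hl : l ≠ 0) :
    ∃ α : ℂ, ‖α‖ = 1 ∧ ∀ z, l z = 0 ↔ (conj α * z).re = 0 := by
  set β : ℂ := ⟨l 1, l Complex.I⟩ with hβ
  have key (z : ℂ) : l z = (conj β * z).re := by
    have : z = z.re • (1 : ℂ) + z.im • Complex.I := by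
      apply Complex.ext <;> simp
    conv_lhs => rw [this]
    rw [map_add, map_smul, map_smul]
    simp [hβ]
    ring
  have hβ0 : β ≠ 0 := by
    intro h
    apply hl
    ext z
    simp [key, h]
  refine ⟨β / ‖β‖, by simp [hβ0], fun z => ?_⟩
  have : conj (β / ‖β‖) * z = ((‖β‖⁻¹ : ℝ) : ℂ) * (conj β * z) := by
    simp; ring
  rw [key, this, Complex.re_ofReal_mul]
  simp [hβ0]

/-- The points of the critical set where the Hessian degenerates. -/
def IsCuspCandidate (p q : ℕ) (a b : ℂ) (x : ℂ × ℂ) : Prop :=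
  ∃ α : ℂ, ‖α‖ = 1 ∧ p * x.1 ^ (p - 1) = -(α ^ 2 * conj a) ∧
    q * x.2 ^ (q - 1) = -(α ^ 2 * conj b) ∧
    (α * (conj a * x.1 / (p - 1 : ℕ) + conj b * x.2 / (q - 1 : ℕ))).re = 0

theorem conj_mul_add_mul_conj_re {α A a h : ℂ} :
    (conj α * (A * h + a * conj h)).re = ((conj α * A + α * conj a) * h).re := by
  simp; ring

/-- Vanishing of `Re (ᾱ dF)` in each variable gives `ᾱ p z^(p-1) + α ā = 0` and its analogue in `w`.
Then `dF(h, k) = -2iα Im (α(ā h + b̄ k))`, so the kernel is a real hyperplane. -/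
theorem isDegenerateCritical_deformedBrieskorn_iff_exists (x : ℂ × ℂ) :
    IsDegenerateCritical (deformedBrieskorn p q a b) x ↔
      ∃ α : ℂ, ‖α‖ = 1 ∧ p * x.1 ^ (p - 1) = -(α ^ 2 * conj a) ∧
        q * x.2 ^ (q - 1) = -(α ^ 2 * conj b) ∧ ∃ h k : ℂ, (h ≠ 0 ∨ k ≠ 0) ∧
        (α * (conj a * h + conj b * k)).im = 0 ∧
        ∀ h' k', (α * (conj a * h' + conj b * k')).im = 0 →
          (conj α * (p * (p - 1 : ℕ) * x.1 ^ (p - 2) * h * h' +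
            q * (q - 1 : ℕ) * x.2 ^ (q - 2) * k * k')).re = 0 := by
  obtain ⟨z, w⟩ := x
  dsimp only
  have crit {α : ℂ} (hα : ‖α‖ = 1) (h1 : p * z ^ (p - 1) = -(α ^ 2 * conj a))
      (h2 : q * w ^ (q - 1) = -(α ^ 2 * conj b)) (h k : ℂ) :
      fderiv ℝ (deformedBrieskorn p q a b) (z, w) (h, k) =
        α * (((-2 * (α * (conj a * h + conj b * k)).im : ℝ) : ℂ) * Complex.I) := by
    have hαα : α * conj α = 1 := by rw [Complex.mul_conj, Complex.normSq_eq_norm_sq, hα]; simp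
    have : (((-2 * (α * (conj a * h + conj b * k)).im : ℝ) : ℂ) * Complex.I) =
        conj (α * (conj a * h + conj b * k)) - α * (conj a * h + conj b * k) := by
      apply Complex.ext <;> simp <;> ring
    rw [this, fderiv_deformedBrieskorn]
    simp only [h1, h2, map_mul, map_add, Complex.conj_conj]
    linear_combination (-(a * conj h) - b * conj k) * hαα
  have ker {α : ℂ} (hα : ‖α‖ = 1) (h1 : p * z ^ (p - 1) = -(α ^ 2 * conj a))
      (h2 : q * w ^ (q - 1) = -(α ^ 2 * conj b)) (h k : ℂ) :
      fderiv ℝ (deformedBrieskorn p q a b) (z, w) (h, k) = 0 ↔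
        (α * (conj a * h + conj b * k)).im = 0 := by
    have hα0 : α ≠ 0 := by rintro rfl; simp at hα
    rw [crit hα h1 h2]
    simp only [mul_eq_zero, hα0, Complex.I_ne_zero, Complex.ofReal_eq_zero, false_or, or_false]
    norm_num
  constructor
  · rintro ⟨l, l0, hl, ⟨h, k⟩, h0, hh, hk⟩
    obtain ⟨α, hα, hlα⟩ := exists_norm_eq_one_of_dual l0
    have hαα : α * conj α = 1 := by rw [Complex.mul_conj, Complex.normSq_eq_norm_sq, hα]; simp
    have zero {c : ℂ} (hc : ∀ h, (c * h).re = 0) : c = 0 := by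
      have := hc (conj c)
      rw [Complex.mul_conj] at this
      simpa using this
    have h1 : p * z ^ (p - 1) = -(α ^ 2 * conj a) := by
      have := zero fun h => by
        have := (hlα _).1 (hl (h, 0))
        rw [fderiv_deformedBrieskorn] at this
        rw [← conj_mul_add_mul_conj_re (A := p * z ^ (p - 1)) (α := α) (a := a)]
        simpa using this
      linear_combination α * this - p * z ^ (p - 1) * hαα
    have h2 : q * w ^ (q - 1) = -(α ^ 2 * conj b) := by
      have := zero fun h => by
        have := (hlα _).1 (hl (0, h))
        rw [fderiv_deformedBrieskorn] at this
        rw [← conj_mul_add_mul_conj_re (A := q * w ^ (q - 1)) (α := α) (a := b)]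
        simpa using this
      linear_combination α * this - q * w ^ (q - 1) * hαα
    refine ⟨α, hα, h1, h2, h, k, ?_, (ker hα h1 h2 h k).1 hh, fun h' k' hk' => ?_⟩
    · by_contra! hc
      exact h0 (by simp [hc])
    · have := (hlα _).1 (hk (h', k') ((ker hα h1 h2 h' k').2 hk'))
      rwa [fderiv_fderiv_deformedBrieskorn] at this
  · rintro ⟨α, hα, h1, h2, h, k, h0, hh, hk⟩
    have hα0 : α ≠ 0 := by rintro rfl; simp at hα
    have hαα : α * conj α = 1 := by rw [Complex.mul_conj, Complex.normSq_eq_norm_sq, hα]; simp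
    have hlv (z : ℂ) : (Complex.reCLM.comp ((ContinuousLinearMap.mul ℝ ℂ) (conj α))) z =
      (conj α * z).re := rfl
    refine ⟨Complex.reCLM.comp ((ContinuousLinearMap.mul ℝ ℂ) (conj α)), fun h' => ?_,
      fun ⟨h', k'⟩ => ?_, (h, k), ?_, (ker hα h1 h2 h k).2 hh, fun ⟨h', k'⟩ hk' => ?_⟩
    · have := DFunLike.congr_fun h' α
      rw [hlv, mul_comm, hαα] at this
      simp at this
    · rw [hlv, crit hα h1 h2, ← mul_assoc, mul_comm (conj α), hαα]
      simp
    · rintro h'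
      simp only [Prod.mk_eq_zero] at h'
      tauto
    · rw [hlv, fderiv_fderiv_deformedBrieskorn]
      exact hk h' k' ((ker hα h1 h2 h' k').1 hk')

/-- A diagonal complex quadratic form is degenerate on a real hyperplane `Im (e h + g k) = 0`
exactly when the inverse form vanishes on the conormal. -/
theorem exists_degenerate_iff {c d e g : ℂ} (hc : c ≠ 0) (hd : d ≠ 0) (heg : e ≠ 0 ∨ g ≠ 0) :
    (∃ h k : ℂ, (h ≠ 0 ∨ k ≠ 0) ∧ (e * h + g * k).im = 0 ∧
      ∀ h' k', (e * h' + g * k').im = 0 → (c * h * h' + d * k * k').re = 0) ↔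
      (e ^ 2 / c + g ^ 2 / d).re = 0 := by
  constructor
  · rintro ⟨h, k, h0, hh, hk⟩
    have hn : (Complex.normSq e + Complex.normSq g) ≠ 0 := by
      rcases heg with h | h
      · exact (add_pos_of_pos_of_nonneg (Complex.normSq_pos.2 h) (Complex.normSq_nonneg _)).ne'
      · exact (add_pos_of_nonneg_of_pos (Complex.normSq_nonneg _) (Complex.normSq_pos.2 h)).ne'
    set n : ℝ := Complex.normSq e + Complex.normSq g
    -- The test vector below is `n` times the orthogonal projection of `(conj (c h), conj (d k))` to
    -- the hyperplane. Pairing shows that its norm is zero, so `(c h, d k)` is a real multiple of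
    -- `-i (e, g)`.
    set s : ℝ := (e * conj (c * h) + g * conj (d * k)).im with hs
    have h1 : (e * conj (n * (c * h) + s * (Complex.I * e)) +
        g * conj (n * (d * k) + s * (Complex.I * g))).im = 0 := by
      have : e * conj (n * (c * h) + s * (Complex.I * e)) +
          g * conj (n * (d * k) + s * (Complex.I * g)) =
          n * (e * conj (c * h) + g * conj (d * k)) - (s * n : ℝ) * Complex.I := by
        push_cast [n, Complex.normSq_eq_conj_mul_self]
        simp
        ring
      rw [this]
      simp only [Complex.sub_im, Complex.im_ofReal_mul, Complex.I_im, ← hs]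
      ring
    have h2 := hk _ _ h1
    have h3 : Complex.normSq (n * (c * h) + s * (Complex.I * e)) +
        Complex.normSq (n * (d * k) + s * (Complex.I * g)) = 0 := by
      set u := n * (c * h) + s * (Complex.I * e) with hu
      set v := n * (d * k) + s * (Complex.I * g) with hv
      have : ((Complex.normSq u + Complex.normSq v : ℝ) : ℂ) =
          n * (c * h * conj u + d * k * conj v) + s * (Complex.I * (e * conj u + g * conj v)) := by
        push_cast [Complex.normSq_eq_conj_mul_self]
        linear_combination conj u * hu + conj v * hv
      have := congrArg Complex.re this
      rw [Complex.ofReal_re, Complex.add_re, Complex.re_ofReal_mul, Complex.re_ofReal_mul, h2,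
        Complex.I_mul_re, h1] at this
      simpa using this
    have hn' : (n : ℂ) ≠ 0 := by exact_mod_cast hn
    obtain ⟨h4, h5⟩ := (add_eq_zero_iff_of_nonneg (Complex.normSq_nonneg _)
      (Complex.normSq_nonneg _)).1 h3
    rw [Complex.normSq_eq_zero] at h4 h5
    have h6 : h = (s / n : ℝ) * (-Complex.I * (e / c)) := by
      push_cast
      field_simp
      linear_combination h4
    have h7 : k = (s / n : ℝ) * (-Complex.I * (g / d)) := by
      push_cast
      field_simp
      linear_combination h5
    have ht : s / n ≠ 0 := by
      intro h'
      rw [h'] at h6 h7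
      simp [h6, h7] at h0
    have : e * h + g * k = (s / n : ℝ) * (-Complex.I * (e ^ 2 / c + g ^ 2 / d)) := by
      rw [h6, h7]
      ring
    rw [this, Complex.im_ofReal_mul] at hh
    have hh := (mul_eq_zero.1 hh).resolve_left ht
    rwa [neg_mul, Complex.neg_im, neg_eq_zero, Complex.I_mul_im] at hh
  · intro hre
    -- This choice turns the form into `Re (-i (e h' + g k')) = Im (e h' + g k')`.
    refine ⟨-Complex.I * e / c, -Complex.I * g / d, ?_, ?_, fun h' k' hk' => ?_⟩
    · rcases heg with h | h
      · left; simp [hc, h]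
      · right; simp [hd, h]
    · have : e * (-Complex.I * e / c) + g * (-Complex.I * g / d) =
        -Complex.I * (e ^ 2 / c + g ^ 2 / d) := by ring
      rw [this]
      simp [hre]
    · have : c * (-Complex.I * e / c) * h' + d * (-Complex.I * g / d) * k' =
        -Complex.I * (e * h' + g * k') := by field_simp; ring
      rw [this]
      simpa using hk'

/-- `exists_degenerate_iff` applies with `e = α ā` and `c = ᾱ p(p-1) z^(p-2)`, and the critical
equation gives `e²/c = -α ā z/(p-1)`. Either `a ≠ 0` forces `z ≠ 0`, or `p = 2` makes the power
trivial; hence `c ≠ 0`. The same holds in `w`. -/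
theorem isDegenerateCritical_deformedBrieskorn_iff (hp : 2 ≤ p) (hq : 2 ≤ q) (hap : a ≠ 0 ∨ p = 2)
    (hbq : b ≠ 0 ∨ q = 2) (hab : a ≠ 0 ∨ b ≠ 0) (x : ℂ × ℂ) :
    IsDegenerateCritical (deformedBrieskorn p q a b) x ↔ IsCuspCandidate p q a b x := by
  rw [isDegenerateCritical_deformedBrieskorn_iff_exists]
  refine exists_congr fun α => and_congr_right fun hα => and_congr_right fun h1 =>
    and_congr_right fun h2 => ?_
  obtain ⟨z, w⟩ := x
  dsimp only at h1 h2 ⊢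
  have hα0 : α ≠ 0 := by rintro rfl; simp at hα
  have hαα : α * conj α = 1 := by rw [Complex.mul_conj, Complex.normSq_eq_norm_sq, hα]; simp
  have hα0' : conj α ≠ 0 := by simpa
  have coeff {n : ℕ} {c u : ℂ} (hn : 2 ≤ n) (hc : c ≠ 0 ∨ n = 2)
      (hu : n * u ^ (n - 1) = -(α ^ 2 * conj c)) :
      conj α * (n * (n - 1 : ℕ) * u ^ (n - 2)) ≠ 0 ∧
      (α * conj c) ^ 2 / (conj α * (n * (n - 1 : ℕ) * u ^ (n - 2))) =
        -(α * (conj c * u / (n - 1 : ℕ))) := by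
    have hn0 : (n : ℂ) ≠ 0 := by norm_cast; omega
    have hn1 : ((n - 1 : ℕ) : ℂ) ≠ 0 := by norm_cast; omega
    have hu0 : u ^ (n - 2) ≠ 0 := by
      rcases hc with hc | rfl
      · apply pow_ne_zero
        rintro rfl
        rw [zero_pow (by omega)] at hu
        simp [hα0, hc] at hu
      · simp
    have hne : conj α * (n * (n - 1 : ℕ) * u ^ (n - 2)) ≠ 0 :=
      mul_ne_zero hα0' (mul_ne_zero (mul_ne_zero hn0 hn1) hu0)
    refine ⟨hne, ?_⟩
    rw [show n - 1 = n - 2 + 1 by omega, pow_succ] at hu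
    rw [div_eq_iff hne]
    field_simp
    linear_combination conj α * conj c * hu - α * conj c ^ 2 * hαα
  obtain ⟨c0, c1⟩ := coeff hp hap h1
  obtain ⟨d0, d1⟩ := coeff hq hbq h2
  have := exists_degenerate_iff c0 d0 (e := α * conj a) (g := α * conj b)
    (by simpa [hα0] using hab)
  rw [c1, d1, ← neg_add, Complex.neg_re, neg_eq_zero, ← mul_add] at this
  rw [← this]
  simp only [mul_add, mul_assoc]

/-- For `p ≥ 3` the Hessian ignores the direction `(1, 0)` along `z = 0`. -/
theorem isDegenerateCritical_of_fst_eq_zero (hp : 3 ≤ p) {w α : ℂ} (hα : ‖α‖ = 1)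
    (hw : q * w ^ (q - 1) = -(α ^ 2 * conj b)) :
    IsDegenerateCritical (deformedBrieskorn p q 0 b) (0, w) := by
  rw [isDegenerateCritical_deformedBrieskorn_iff_exists]
  refine ⟨α, hα, ?_, hw, 1, 0, by simp, by simp, ?_⟩
  · simp; omega
  · intro h' k' _
    simp [zero_pow (show p - 2 ≠ 0 by omega)]

theorem isDegenerateCritical_of_snd_eq_zero (hq : 3 ≤ q) {z α : ℂ} (hα : ‖α‖ = 1)
    (hz : p * z ^ (p - 1) = -(α ^ 2 * conj a)) :
    IsDegenerateCritical (deformedBrieskorn p q a 0) (z, 0) := by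
  rw [isDegenerateCritical_deformedBrieskorn_iff_exists]
  refine ⟨α, hα, hz, ?_, 0, 1, by simp, by simp, ?_⟩
  · simp; omega
  · intro h' k' _
    simp [zero_pow (show q - 2 ≠ 0 by omega)]

end DeformedBrieskorn

/-! ### Zeros of two-term trigonometric polynomials on the circle. -/

section TrigZeros

/-- The zeros on the unit circle of the trigonometric polynomial `Re (A x^m + B x^n)`. -/
def trigZeros (A B : ℂ) (m n : ℕ) : Set ℂ := {x | ‖x‖ = 1 ∧ (A * x ^ m + B * x ^ n).re = 0}

open Polynomial in
-- On the unit circle `2 x^n Re (A x^m + B x^n)` is a polynomial of degree at most `2n`; the point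
-- `x₀` certifies that it is nonzero.
theorem trigZeros_upper {A B : ℂ} {m n : ℕ} (hmn : m ≤ n) {x₀ : ℂ} (h0 : ‖x₀‖ = 1)
    (hx₀ : x₀ ∉ trigZeros A B m n) :
    (trigZeros A B m n).Finite ∧ (trigZeros A B m n).ncard ≤ 2 * n := by
  let P : ℂ[X] := C A * X ^ (n + m) + C B * X ^ (2 * n) + C (conj A) * X ^ (n - m) + C (conj B)
  have hP {x : ℂ} (hx : ‖x‖ = 1) : P.eval x = x ^ n * (2 * (A * x ^ m + B * x ^ n).re : ℝ) := by
    have hx' : x * conj x = 1 := by rw [Complex.mul_conj, Complex.normSq_eq_norm_sq, hx]; simp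
    have e1 : x ^ n * conj x ^ n = 1 := by rw [← mul_pow, hx', one_pow]
    have e2 : x ^ n * conj x ^ m = x ^ (n - m) := by
      conv_lhs => rw [← Nat.sub_add_cancel hmn, pow_add, mul_assoc, ← mul_pow, hx']
      simp
    have : ((2 * (A * x ^ m + B * x ^ n).re : ℝ) : ℂ) = A * x ^ m + B * x ^ n +
        conj A * conj x ^ m + conj B * conj x ^ n := by
      rw [← Complex.add_conj]
      simp; ring
    rw [this]
    simp [P]
    linear_combination - conj B * e1 - conj A * e2
  have hsub : trigZeros A B m n ⊆ P.roots.toFinset := by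
    intro x ⟨hx, hx0⟩
    have hne : P ≠ 0 := by
      intro h
      apply hx₀
      refine ⟨h0, ?_⟩
      have := hP h0
      have hx0 : x₀ ≠ 0 := by rintro rfl; simp at h0
      rw [h, eval_zero] at this
      have := (mul_eq_zero.1 this.symm).resolve_left (pow_ne_zero _ hx0)
      rw [Complex.ofReal_eq_zero] at this
      linarith
    simp [hne, hP hx, hx0]
  refine ⟨(Finset.finite_toSet _).subset hsub, ?_⟩
  calc _ ≤ (P.roots.toFinset : Set ℂ).ncard := Set.ncard_le_ncard hsub (Finset.finite_toSet _)
    _ = P.roots.toFinset.card := Set.ncard_coe_finset _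
    _ ≤ P.roots.card := Multiset.toFinset_card_le _
    _ ≤ P.natDegree := P.card_roots'
    _ ≤ 2 * n := by
      simp only [P]
      compute_degree
      omega

theorem le_encard_trigZeros_of_injOn {A B : ℂ} {m n N : ℕ} (t : ℕ → ℝ) {s : ℝ}
    (hs : ∀ j < N, t j ∈ Set.Ico s (s + 2 * Real.pi)) (ht : Set.InjOn t (Set.Iio N))
    (h0 : ∀ j < N, (A * Complex.exp (t j * Complex.I) ^ m +
      B * Complex.exp (t j * Complex.I) ^ n).re = 0) : (N : ℕ∞) ≤ (trigZeros A B m n).encard := by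
  have hN : (Set.Iio N).encard = N := by
    rw [← Finset.coe_Iio, Set.encard_coe_eq_coe_finsetCard]; simp
  rw [← hN]
  apply Set.encard_le_encard_of_injOn (f := fun j => Complex.exp (t j * Complex.I))
  · intro j hj
    exact ⟨Complex.norm_exp_ofReal_mul_I _, h0 j hj⟩
  · intro i hi j hj hij
    apply ht hi hj
    obtain ⟨k, hk⟩ := Complex.exp_eq_exp_iff_exists_int.1 hij
    have hk' : t i = t j + k * (2 * Real.pi) := by
      have := congrArg Complex.im hk
      simpa using this
    have h1 := hs i hi
    have h2 := hs j hj
    have hk1 : (k : ℝ) < 1 := by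
      by_contra! h
      nlinarith [Real.pi_pos, h1.1, h1.2, h2.1, h2.2]
    have hk2 : (-1 : ℝ) < k := by
      by_contra! h
      nlinarith [Real.pi_pos, h1.1, h1.2, h2.1, h2.2]
    have : k = 0 := by
      have : k < 1 := by exact_mod_cast hk1
      have : -1 < k := by exact_mod_cast hk2
      omega
    simpa [this] using hk'

theorem re_mul_exp_pow (A : ℂ) (t : ℝ) (m : ℕ) :
    (A * Complex.exp (t * Complex.I) ^ m).re = ‖A‖ * Real.cos (m * t + A.arg) := by
  conv_lhs => rw [← Complex.norm_mul_exp_arg_mul_I A]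
  rw [mul_assoc, ← Complex.exp_nat_mul, ← Complex.exp_add, Complex.re_ofReal_mul]
  congr 1
  rw [← Complex.exp_ofReal_mul_I_re]
  push_cast
  ring_nf

/-- The dominant frequency forces sign changes. -/
theorem le_encard_trigZeros_of_norm_lt {A B : ℂ} {m n : ℕ} (hm : 0 < m) (hAB : ‖B‖ < ‖A‖) :
    ((2 * m : ℕ) : ℕ∞) ≤ (trigZeros A B m n).encard := by
  let f : ℝ → ℝ := fun t => ‖A‖ * Real.cos (m * t + A.arg) + ‖B‖ * Real.cos (n * t + B.arg)
  -- At `θ j` the dominant cosine equals `(-1)^j`, so `f` changes sign between consecutive nodes.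
  let θ : ℕ → ℝ := fun j => (j * Real.pi - A.arg) / m
  have hm' : (0 : ℝ) < m := by exact_mod_cast hm
  have hθ (j : ℕ) : f (θ j) = ‖A‖ * (-1) ^ j + ‖B‖ * Real.cos (n * θ j + B.arg) := by
    have : m * θ j + A.arg = j * Real.pi := by simp only [θ]; field_simp; ring
    simp only [f, this, Real.cos_nat_mul_pi]
  have hBn (s : ℝ) : |‖B‖ * Real.cos s| < ‖A‖ := by
    rw [abs_mul, abs_norm]
    exact (mul_le_of_le_one_right (norm_nonneg _) (Real.abs_cos_le_one s)).trans_lt hAB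
  have hmono : StrictMono θ := strictMono_nat_of_lt_succ fun j => by
    simp only [θ]
    push_cast
    gcongr
    linarith [Real.pi_pos]
  have hex (j : ℕ) : ∃ t ∈ Set.Ioo (θ j) (θ (j + 1)), f t = 0 := by
    have hf : ContinuousOn f (Set.Icc (θ j) (θ (j + 1))) := by fun_prop
    have h1 := abs_lt.1 (hBn (n * θ j + B.arg))
    have h2 := abs_lt.1 (hBn (n * θ (j + 1) + B.arg))
    have e1 := hθ j
    have e2 := hθ (j + 1)
    have hle := (hmono (Nat.lt_succ_self j)).le
    rcases Nat.even_or_odd j with hj | hj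
    · rw [hj.neg_one_pow] at e1
      rw [(hj.add_one).neg_one_pow] at e2
      exact intermediate_value_Ioo' hle hf ⟨by linarith, by linarith⟩
    · rw [hj.neg_one_pow] at e1
      rw [(hj.add_one).neg_one_pow] at e2
      exact intermediate_value_Ioo hle hf ⟨by linarith, by linarith⟩
  choose t ht h0 using hex
  have htm : StrictMono t := strictMono_nat_of_lt_succ fun j => (ht j).2.trans (ht (j + 1)).1
  refine le_encard_trigZeros_of_injOn t (s := θ 0) (fun j hj => ⟨?_, ?_⟩) htm.injective.injOn
    fun j _ => ?_
  · exact (hmono.monotone (Nat.zero_le j)).trans (ht j).1.le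
  · have e : θ (2 * m) = θ 0 + 2 * Real.pi := by
      simp only [θ]; push_cast; field_simp; ring
    rw [← e]
    exact (ht j).2.trans_le (hmono.monotone hj)
  · rw [Complex.add_re, re_mul_exp_pow, re_mul_exp_pow]
    exact h0 j

theorem trigZeros_comm (A B : ℂ) (m n : ℕ) : trigZeros A B m n = trigZeros B A n m := by
  simp only [trigZeros, add_comm]

theorem le_encard_trigZeros {A B : ℂ} {m n : ℕ} (hm : 0 < m) (hmn : m ≤ n) :
    ((2 * m : ℕ) : ℕ∞) ≤ (trigZeros A B m n).encard := by
  have hle : ((2 * m : ℕ) : ℕ∞) ≤ (2 * n : ℕ) := by gcongr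
  rcases lt_trichotomy ‖A‖ ‖B‖ with h | h | h
  · rw [trigZeros_comm]
    exact hle.trans (le_encard_trigZeros_of_norm_lt (hm.trans_le hmn) h)
  · have hle' : ((2 * m : ℕ) : ℕ∞) ≤ (m + n : ℕ) := by gcongr; omega
    refine hle'.trans ?_
    have hN : (0 : ℝ) < m + n := by positivity
    -- For equal amplitudes the sum of cosines is a product; these are the zeros of its factor of
    -- frequency `(m + n)/2`.
    let θ : ℕ → ℝ := fun j => (Real.pi + 2 * Real.pi * j - A.arg - B.arg) / (m + n)
    have hmono : StrictMono θ := strictMono_nat_of_lt_succ fun j => by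
      simp only [θ]
      push_cast
      gcongr
      linarith [Real.pi_pos]
    refine le_encard_trigZeros_of_injOn θ (s := θ 0) (fun j hj => ⟨hmono.monotone (Nat.zero_le j),
      ?_⟩) hmono.injective.injOn fun j _ => ?_
    · have e : θ (m + n) = θ 0 + 2 * Real.pi := by
        simp only [θ]; push_cast; field_simp; ring
      rw [← e]
      exact hmono hj
    · rw [Complex.add_re, re_mul_exp_pow, re_mul_exp_pow, h, ← mul_add, Real.cos_add_cos]
      have : (m * θ j + A.arg + (n * θ j + B.arg)) / 2 = Real.pi / 2 + j * Real.pi := by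
        have : (m + n) * θ j = Real.pi + 2 * Real.pi * j - A.arg - B.arg := by
          simp only [θ]; field_simp
        linarith
      rw [this, Real.cos_add_nat_mul_pi]
      simp
  · exact le_encard_trigZeros_of_norm_lt hm h

end TrigZeros

/-! ### Parametrization of the critical set and the count of cusps. -/

section CuspCount

variable {p q : ℕ} {a b z₀ w₀ : ℂ}

/-- Parametrization of the critical set. -/
def critParam (p q : ℕ) (z₀ w₀ : ℂ) (y : ℂ × ℂ) : ℂ × ℂ :=
  (z₀ * y.1 ^ (2 * (q - 1)), w₀ * y.2 * y.1 ^ (2 * (p - 1)))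

/-- The exponents in `critParam` are chosen so that both equations acquire the same factor `α²`,
with `α = x^((p-1)(q-1))`. -/
theorem critParam_mem (hz₀ : p * z₀ ^ (p - 1) = -conj a) (hw₀ : q * w₀ ^ (q - 1) = -conj b)
    {x ζ : ℂ} (hζ : ζ ^ (q - 1) = 1) :
    p * (critParam p q z₀ w₀ (x, ζ)).1 ^ (p - 1) = -((x ^ ((p - 1) * (q - 1))) ^ 2 * conj a) ∧
    q * (critParam p q z₀ w₀ (x, ζ)).2 ^ (q - 1) = -((x ^ ((p - 1) * (q - 1))) ^ 2 * conj b) := by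
  have e1 : (x ^ (2 * (q - 1))) ^ (p - 1) = (x ^ ((p - 1) * (q - 1))) ^ 2 := by
    rw [← pow_mul, ← pow_mul]; congr 1; ring
  have e2 : (x ^ (2 * (p - 1))) ^ (q - 1) = (x ^ ((p - 1) * (q - 1))) ^ 2 := by
    rw [← pow_mul, ← pow_mul]; congr 1; ring
  simp only [critParam, mul_pow, hζ, e1, e2]
  constructor
  · linear_combination (x ^ ((p - 1) * (q - 1))) ^ 2 * hz₀
  · linear_combination (x ^ ((p - 1) * (q - 1))) ^ 2 * hw₀

theorem critParam_form (hp : 2 ≤ p) (hq : 2 ≤ q) (x ζ : ℂ) :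
    x ^ ((p - 1) * (q - 1)) * (conj a * (critParam p q z₀ w₀ (x, ζ)).1 / (p - 1 : ℕ) +
      conj b * (critParam p q z₀ w₀ (x, ζ)).2 / (q - 1 : ℕ)) =
    conj a * z₀ / (p - 1 : ℕ) * x ^ ((p + 1) * (q - 1)) +
      conj b * w₀ / (q - 1 : ℕ) * ζ * x ^ ((q + 1) * (p - 1)) := by
  have e1 : (p + 1) * (q - 1) = (p - 1) * (q - 1) + 2 * (q - 1) := by
    obtain ⟨p, rfl⟩ := Nat.exists_eq_add_of_le hp
    rw [← add_mul]; congr 1; omega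
  have e2 : (q + 1) * (p - 1) = (p - 1) * (q - 1) + 2 * (p - 1) := by
    rw [mul_comm (p - 1), ← add_mul]; congr 1; omega
  rw [e1, e2, pow_add, pow_add]
  simp only [critParam]
  ring

/-- Two parameters give the same critical point exactly when they differ by the action of a
`2(q-1)`-th root of unity. -/
theorem critParam_eq_iff (hp : 2 ≤ p) (hq : 2 ≤ q) (hz : z₀ ≠ 0 ∨ (p = 2 ∧ q = 2))
    (hw : w₀ ≠ 0 ∨ q = 2) (hzw : z₀ ≠ 0 ∨ w₀ ≠ 0) {x ζ u v : ℂ} (hx : x ≠ 0) (hζ : ζ ^ (q - 1) = 1)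
    (hv : v ^ (q - 1) = 1) :
    critParam p q z₀ w₀ (u * x, v * ζ) = critParam p q z₀ w₀ (x, ζ) ↔
      u ^ (2 * (q - 1)) = 1 ∧ v * u ^ (2 * (p - 1)) = 1 := by
  have hζ0 : ζ ≠ 0 := by
    rintro rfl
    rw [zero_pow (by omega)] at hζ
    simp at hζ
  have e1 : z₀ * (u * x) ^ (2 * (q - 1)) = z₀ * x ^ (2 * (q - 1)) ↔
      z₀ = 0 ∨ u ^ (2 * (q - 1)) = 1 := by
    rw [← sub_eq_zero, show z₀ * (u * x) ^ (2 * (q - 1)) - z₀ * x ^ (2 * (q - 1)) =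
      z₀ * x ^ (2 * (q - 1)) * (u ^ (2 * (q - 1)) - 1) by rw [mul_pow]; ring, mul_eq_zero,
      mul_eq_zero, sub_eq_zero]
    simp [pow_ne_zero _ hx]
  have e2 : w₀ * (v * ζ) * (u * x) ^ (2 * (p - 1)) = w₀ * ζ * x ^ (2 * (p - 1)) ↔
      w₀ = 0 ∨ v * u ^ (2 * (p - 1)) = 1 := by
    rw [← sub_eq_zero, show w₀ * (v * ζ) * (u * x) ^ (2 * (p - 1)) -
      w₀ * ζ * x ^ (2 * (p - 1)) = w₀ * ζ * x ^ (2 * (p - 1)) * (v * u ^ (2 * (p - 1)) - 1) by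
        rw [mul_pow]; ring, mul_eq_zero, mul_eq_zero, mul_eq_zero, sub_eq_zero]
    simp [pow_ne_zero _ hx, hζ0]
  simp only [critParam, Prod.mk.injEq, e1, e2]
  by_cases hw' : w₀ = 0
  · have hz' : z₀ ≠ 0 := by tauto
    obtain rfl : q = 2 := by tauto
    have hv1 : v = 1 := by simpa using hv
    simp only [hw', hz', false_or, true_or, and_true, hv1, one_mul]
    refine ⟨fun h => ⟨h, ?_⟩, And.left⟩
    rw [pow_mul, show u ^ 2 = 1 by simpa using h, one_pow]
  · by_cases hz' : z₀ = 0
    · obtain ⟨rfl, rfl⟩ := hz.resolve_left (by simpa)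
      have hv1 : v = 1 := by simpa using hv
      simp [hw', hz', hv1]
    · simp [hw', hz']

/-- A `2(q-1)`-th root of `z / z₀` supplies `x`, and `w` then determines `ζ`, unless `z₀` or `w₀` is
zero. Only `α²` is recovered, which suffices: the cusp equation is unchanged under `α ↦ -α`. -/
theorem exists_critParam_eq (hp : 2 ≤ p) (hq : 2 ≤ q) (hz : z₀ ≠ 0 ∨ (p = 2 ∧ q = 2))
    (hw : w₀ ≠ 0 ∨ q = 2) (hz₀ : p * z₀ ^ (p - 1) = -conj a) (hw₀ : q * w₀ ^ (q - 1) = -conj b)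
    (hzw : z₀ ≠ 0 ∨ w₀ ≠ 0) {α : ℂ} (hα : ‖α‖ = 1) {z w : ℂ}
    (h1 : p * z ^ (p - 1) = -(α ^ 2 * conj a)) (h2 : q * w ^ (q - 1) = -(α ^ 2 * conj b)) :
    ∃ x ζ : ℂ, ‖x‖ = 1 ∧ ζ ^ (q - 1) = 1 ∧ critParam p q z₀ w₀ (x, ζ) = (z, w) ∧
      (x ^ ((p - 1) * (q - 1))) ^ 2 = α ^ 2 := by
  have hp0 : (p : ℂ) ≠ 0 := by norm_cast; omega
  have hq0 : (q : ℂ) ≠ 0 := by norm_cast; omega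
  have hα0 : α ≠ 0 := by rintro rfl; simp at hα
  have hzp : z ^ (p - 1) = α ^ 2 * z₀ ^ (p - 1) := by
    apply mul_left_cancel₀ hp0
    linear_combination h1 - α ^ 2 * hz₀
  have hwq : w ^ (q - 1) = α ^ 2 * w₀ ^ (q - 1) := by
    apply mul_left_cancel₀ hq0
    linear_combination h2 - α ^ 2 * hw₀
  have norm_one {x : ℂ} (h : (x ^ ((p - 1) * (q - 1))) ^ 2 = α ^ 2) : ‖x‖ = 1 := by
    have := congrArg norm h
    rw [norm_pow, norm_pow, norm_pow, hα, one_pow, ← pow_mul] at this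
    exact (pow_eq_one_iff_of_nonneg (norm_nonneg _) (by
      simp; omega)).1 this
  by_cases hz' : z₀ = 0
  · obtain ⟨rfl, rfl⟩ := hz.resolve_left (by simpa)
    have hw' : w₀ ≠ 0 := by tauto
    simp only [Nat.add_one_sub_one, pow_one, mul_one] at *
    refine ⟨α, 1, hα, rfl, ?_, rfl⟩
    simp [critParam, hzp, hz', hwq, mul_comm]
  · obtain ⟨x, hx⟩ := IsAlgClosed.exists_pow_nat_eq (z / z₀) (n := 2 * (q - 1)) (by omega)
    have hxα : (x ^ ((p - 1) * (q - 1))) ^ 2 = α ^ 2 := by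
      rw [show (x ^ ((p - 1) * (q - 1))) ^ 2 = (x ^ (2 * (q - 1))) ^ (p - 1) by
        rw [← pow_mul, ← pow_mul]; congr 1; ring, hx, div_pow, hzp]
      field_simp
    have hx1 := norm_one hxα
    have hx0 : x ≠ 0 := by rintro rfl; simp at hx1
    have hxz : z₀ * x ^ (2 * (q - 1)) = z := by rw [hx]; field_simp
    by_cases hw' : w₀ = 0
    · obtain rfl : q = 2 := by tauto
      refine ⟨x, 1, hx1, by simp, ?_, hxα⟩
      have : w = 0 := by simpa [hw'] using hwq
      simp only [critParam, hxz, hw', this, zero_mul]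
    · refine ⟨x, w / (w₀ * x ^ (2 * (p - 1))), hx1, ?_, ?_, hxα⟩
      · rw [div_pow, hwq, mul_pow, show (x ^ (2 * (p - 1))) ^ (q - 1) =
          (x ^ ((p - 1) * (q - 1))) ^ 2 by rw [← pow_mul, ← pow_mul]; congr 1; ring, hxα]
        field_simp
      · simp only [critParam, hxz]
        congr 1
        field_simp

theorem IsExcellentMap.eventually_eq_of_curve {E F : Type*} [NormedAddCommGroup E]
    [NormedSpace ℝ E] [NormedAddCommGroup F] [NormedSpace ℝ F] {f : E → F} (hf : IsExcellentMap f)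
    {γ : ℝ → E} (hγ : Continuous γ) (h : ∀ t, IsDegenerateCritical f (γ t)) :
    ∀ᶠ t in nhds 0, γ t = γ 0 := by
  filter_upwards [hγ.continuousAt.eventually (hf.eventually_eq (h 0))] with t ht using ht (h t)

theorem not_eventually_exp_pow_eq_one {N : ℕ} (hN : N ≠ 0) :
    ¬ ∀ᶠ t : ℝ in nhds 0, Complex.exp (t * Complex.I) ^ N = 1 := by
  intro h
  have h1 : HasDerivAt (fun t : ℝ => Complex.exp (t * Complex.I) ^ N) (N * Complex.I) 0 := by
    have := (((hasDerivAt_id (0 : ℝ)).ofReal_comp.mul_const Complex.I).cexp).pow N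
    simp only [id, Complex.ofReal_zero, Complex.ofReal_one, zero_mul, Complex.exp_zero, one_pow,
      mul_one, one_mul] at this
    exact this
  have h2 : HasDerivAt (fun t : ℝ => Complex.exp (t * Complex.I) ^ N) 0 0 :=
    (hasDerivAt_const (0 : ℝ) (1 : ℂ)).congr_of_eventuallyEq h
  simpa [hN] using h1.unique h2

theorem exists_nat_mul_pow_eq {n : ℕ} (hn : 2 ≤ n) (c : ℂ) :
    ∃ z : ℂ, n * z ^ (n - 1) = -conj c ∧ (c ≠ 0 → z ≠ 0) := by
  have hn0 : (n : ℂ) ≠ 0 := by norm_cast; omega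
  obtain ⟨z, hz⟩ := IsAlgClosed.exists_pow_nat_eq (-conj c / n) (n := n - 1) (by omega)
  refine ⟨z, by rw [hz]; field_simp, ?_⟩
  rintro hc rfl
  rw [zero_pow (by omega)] at hz
  exact div_ne_zero (neg_ne_zero.2 (by simpa using hc)) hn0 hz.symm

/-- If `a = b = 0`, the differential vanishes at the origin. If only `a = 0` and `p ≥ 3`, a whole
circle in `z = 0` is degenerate, against isolation; likewise for `b` and `q`. -/
theorem IsExcellentMap.deformedBrieskorn_conditions (hp : 2 ≤ p) (hq : 2 ≤ q)
    (hf : IsExcellentMap (deformedBrieskorn p q a b)) :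
    (a ≠ 0 ∨ p = 2) ∧ (b ≠ 0 ∨ q = 2) ∧ (a ≠ 0 ∨ b ≠ 0) := by
  have hab : a ≠ 0 ∨ b ≠ 0 := by
    by_contra! h
    refine (hf.fderiv_ne_zero_and_isCuspPoint_iff 0).1 ?_
    refine ContinuousLinearMap.ext fun v => ?_
    rw [fderiv_deformedBrieskorn]
    simp [h, zero_pow (show p - 1 ≠ 0 by omega), zero_pow (show q - 1 ≠ 0 by omega)]
  have hexp (N : ℕ) (t : ℝ) : ‖Complex.exp (t * Complex.I) ^ N‖ = 1 := by
    rw [norm_pow, Complex.norm_exp_ofReal_mul_I, one_pow]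
  have hcont : Continuous fun t : ℝ => Complex.exp (t * Complex.I) := by fun_prop
  have point {n : ℕ} {c u : ℂ} (hu : n * u ^ (n - 1) = -conj c) (x : ℂ) :
      n * (u * x ^ 2) ^ (n - 1) = -((x ^ (n - 1)) ^ 2 * conj c) := by
    rw [mul_pow, ← pow_mul, mul_comm 2, pow_mul]
    linear_combination (x ^ (n - 1)) ^ 2 * hu
  refine ⟨?_, ?_, hab⟩
  · by_contra! h
    obtain ⟨rfl, hp2⟩ := h
    obtain ⟨w, hw, hw0⟩ := exists_nat_mul_pow_eq hq b
    have hw0 := hw0 (by simpa using hab)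
    refine not_eventually_exp_pow_eq_one two_ne_zero ?_
    have := hf.eventually_eq_of_curve
      (γ := fun t : ℝ => ((0 : ℂ), w * Complex.exp (t * Complex.I) ^ 2)) (by fun_prop)
      fun t => isDegenerateCritical_of_fst_eq_zero (by omega) (hexp _ t) (point hw _)
    filter_upwards [this] with t ht
    simpa [hw0] using ht
  · by_contra! h
    obtain ⟨rfl, hq2⟩ := h
    obtain ⟨z, hz, hz0⟩ := exists_nat_mul_pow_eq hp a
    have hz0 := hz0 (by simpa using hab)
    refine not_eventually_exp_pow_eq_one two_ne_zero ?_
    have := hf.eventually_eq_of_curve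
      (γ := fun t : ℝ => (z * Complex.exp (t * Complex.I) ^ 2, (0 : ℂ))) (by fun_prop)
      fun t => isDegenerateCritical_of_snd_eq_zero (by omega) (hexp _ t) (point hz _)
    filter_upwards [this] with t ht
    simpa [hz0] using ht

/-- The cusp equation on the branch of the critical set labelled by `ζ`. -/
abbrev branchZeros (p q : ℕ) (a b z₀ w₀ ζ : ℂ) : Set ℂ :=
  trigZeros (conj a * z₀ / (p - 1 : ℕ)) (conj b * w₀ / (q - 1 : ℕ) * ζ)
    ((p + 1) * (q - 1)) ((q + 1) * (p - 1))

theorem isCuspCandidate_critParam (hp : 2 ≤ p) (hq : 2 ≤ q) (hz₀ : p * z₀ ^ (p - 1) = -conj a)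
    (hw₀ : q * w₀ ^ (q - 1) = -conj b) {x ζ : ℂ} (hζ : ζ ^ (q - 1) = 1)
    (hx : x ∈ branchZeros p q a b z₀ w₀ ζ) :
    IsCuspCandidate p q a b (critParam p q z₀ w₀ (x, ζ)) := by
  obtain ⟨h1, h2⟩ := critParam_mem hz₀ hw₀ (x := x) hζ
  refine ⟨x ^ ((p - 1) * (q - 1)), by rw [norm_pow, hx.1, one_pow], h1, h2, ?_⟩
  rw [critParam_form hp hq]
  exact hx.2

theorem exists_branch_of_isCuspCandidate (hp : 2 ≤ p) (hq : 2 ≤ q)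
    (hz : z₀ ≠ 0 ∨ (p = 2 ∧ q = 2)) (hw : w₀ ≠ 0 ∨ q = 2) (hz₀ : p * z₀ ^ (p - 1) = -conj a)
    (hw₀ : q * w₀ ^ (q - 1) = -conj b) (hzw : z₀ ≠ 0 ∨ w₀ ≠ 0) {c : ℂ × ℂ}
    (hc : IsCuspCandidate p q a b c) :
    ∃ x ζ : ℂ, ζ ^ (q - 1) = 1 ∧ x ∈ branchZeros p q a b z₀ w₀ ζ ∧
      critParam p q z₀ w₀ (x, ζ) = c := by
  obtain ⟨z, w⟩ := c
  obtain ⟨α, hα, h1, h2, h3⟩ := hc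
  obtain ⟨x, ζ, hx, hζ, hc, hxα⟩ := exists_critParam_eq hp hq hz hw hz₀ hw₀ hzw hα h1 h2
  refine ⟨x, ζ, hζ, ⟨hx, ?_⟩, hc⟩
  rw [← critParam_form hp hq, hc]
  rcases sq_eq_sq_iff_eq_or_eq_neg.1 hxα with h | h
  · rw [h]
    exact h3
  · rw [h, neg_mul, Complex.neg_re, neg_eq_zero]
    exact h3

/-- Passing from `x` to `u x` fixes the critical point and changes `α` by a sign only. -/
theorem mul_mem_branchZeros (hp : 2 ≤ p) (hq : 2 ≤ q) {x ζ u v : ℂ}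
    (hu : u ^ (2 * (q - 1)) = 1) (hx : x ∈ branchZeros p q a b z₀ w₀ ζ)
    (h : critParam p q z₀ w₀ (u * x, v * ζ) = critParam p q z₀ w₀ (x, ζ)) :
    u * x ∈ branchZeros p q a b z₀ w₀ (v * ζ) := by
  have hu1 : ‖u‖ = 1 := Complex.norm_eq_one_of_pow_eq_one hu (by omega)
  refine ⟨by rw [norm_mul, hu1, hx.1, one_mul], ?_⟩
  have hx2 := hx.2
  rw [← critParam_form hp hq] at hx2 ⊢
  have : (u ^ ((p - 1) * (q - 1))) ^ 2 = 1 := by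
    rw [← pow_mul, show (p - 1) * (q - 1) * 2 = 2 * (q - 1) * (p - 1) by ring, pow_mul, hu,
      one_pow]
  rw [h, mul_pow]
  rcases mul_self_eq_one_iff.1 ((sq _).symm.trans this) with h' | h'
  · rw [h', one_mul]
    exact hx2
  · rw [h', neg_one_mul, neg_mul, Complex.neg_re, neg_eq_zero]
    exact hx2

/-- Otherwise the branch would be a nonconstant curve of degenerate critical points. -/
theorem IsExcellentMap.exists_notMem_branchZeros (hp : 2 ≤ p) (hq : 2 ≤ q)
    (hf : IsExcellentMap (deformedBrieskorn p q a b))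
    (hz : z₀ ≠ 0 ∨ (p = 2 ∧ q = 2)) (hw : w₀ ≠ 0 ∨ q = 2) (hz₀ : p * z₀ ^ (p - 1) = -conj a)
    (hw₀ : q * w₀ ^ (q - 1) = -conj b) (hzw : z₀ ≠ 0 ∨ w₀ ≠ 0) {ζ : ℂ} (hζ : ζ ^ (q - 1) = 1) :
    ∃ x : ℂ, ‖x‖ = 1 ∧ x ∉ branchZeros p q a b z₀ w₀ ζ := by
  by_contra! h
  obtain ⟨hap, hbq, hab⟩ := hf.deformedBrieskorn_conditions hp hq
  refine not_eventually_exp_pow_eq_one (N := 2 * (q - 1)) (by omega) ?_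
  have := hf.eventually_eq_of_curve
    (γ := fun t : ℝ => critParam p q z₀ w₀ (Complex.exp (t * Complex.I), ζ))
    (by unfold critParam; fun_prop) fun t =>
      (isDegenerateCritical_deformedBrieskorn_iff hp hq hap hbq hab _).2
        (isCuspCandidate_critParam hp hq hz₀ hw₀ hζ (h _ (Complex.norm_exp_ofReal_mul_I t)))
  filter_upwards [this] with t ht
  have := (critParam_eq_iff hp hq hz hw hzw one_ne_zero hζ (one_pow _)
    (u := Complex.exp (t * Complex.I)) (v := 1)).1 (by simpa using ht)
  exact this.1

theorem IsExcellentMap.cuspSet_finite_and_ncard (hq : 2 ≤ q) (hpq : q ≤ p)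
    (hf : IsExcellentMap (deformedBrieskorn p q a b)) :
    (cuspSet (deformedBrieskorn p q a b)).Finite ∧
    (p + 1) * (q - 1) ≤ (cuspSet (deformedBrieskorn p q a b)).ncard ∧
    (cuspSet (deformedBrieskorn p q a b)).ncard ≤ (q + 1) * (p - 1) := by
  classical
  have hp : 2 ≤ p := hq.trans hpq
  obtain ⟨hap, hbq, hab⟩ := hf.deformedBrieskorn_conditions hp hq
  obtain ⟨z₀, hz₀, hz⟩ := exists_nat_mul_pow_eq hp a
  obtain ⟨w₀, hw₀, hw⟩ := exists_nat_mul_pow_eq hq b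
  have hz' : z₀ ≠ 0 ∨ (p = 2 ∧ q = 2) := hap.imp hz fun h => ⟨h, by omega⟩
  have hw' : w₀ ≠ 0 ∨ q = 2 := hbq.imp_left hw
  have hzw : z₀ ≠ 0 ∨ w₀ ≠ 0 := hab.imp hz hw
  have hm : 0 < (p + 1) * (q - 1) := Nat.mul_pos (by omega) (by omega)
  -- The difference of the two sides is `2(p - q)`.
  have hmn : (p + 1) * (q - 1) ≤ (q + 1) * (p - 1) := by
    obtain ⟨q, rfl⟩ := Nat.exists_eq_add_of_le' (show 1 ≤ q by omega)
    obtain ⟨p, rfl⟩ := Nat.exists_eq_add_of_le' (show 1 ≤ p by omega)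
    simp only [Nat.add_sub_cancel]
    nlinarith
  have hZ (ζ : ℂ) : ∃ s : Finset ℂ, ζ ^ (q - 1) = 1 → (s : Set ℂ) = branchZeros p q a b z₀ w₀ ζ ∧
      2 * ((p + 1) * (q - 1)) ≤ s.card ∧ s.card ≤ 2 * ((q + 1) * (p - 1)) := by
    by_cases hζ : ζ ^ (q - 1) = 1
    · obtain ⟨x, hx, hx'⟩ := hf.exists_notMem_branchZeros hp hq hz' hw' hz₀ hw₀ hzw hζ
      obtain ⟨hfin, hcard⟩ := trigZeros_upper hmn hx hx'
      refine ⟨hfin.toFinset, fun _ => ⟨hfin.coe_toFinset, ?_, ?_⟩⟩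
      · have := le_encard_trigZeros (A := conj a * z₀ / (p - 1 : ℕ))
          (B := conj b * w₀ / (q - 1 : ℕ) * ζ) hm hmn
        rw [hfin.encard_eq_coe_toFinset_card] at this
        exact_mod_cast this
      · rwa [Set.ncard_eq_toFinset_card _ hfin] at hcard
    · exact ⟨∅, fun h => absurd h hζ⟩
  choose Z hZ using hZ
  have hq1 : 0 < q - 1 := by omega
  have hroots {ζ : ℂ} : ζ ∈ Polynomial.nthRootsFinset (q - 1) (1 : ℂ) ↔ ζ ^ (q - 1) = 1 :=
    Polynomial.mem_nthRootsFinset hq1 1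
  let T := (Polynomial.nthRootsFinset (q - 1) (1 : ℂ)).sigma Z
  let Φ : (Σ _ : ℂ, ℂ) → ℂ × ℂ := fun y => critParam p q z₀ w₀ (y.2, y.1)
  have hT {y : Σ _ : ℂ, ℂ} : y ∈ T ↔ y.1 ^ (q - 1) = 1 ∧
      y.2 ∈ branchZeros p q a b z₀ w₀ y.1 := by
    rw [Finset.mem_sigma, hroots]
    refine and_congr_right fun h => ?_
    rw [← (hZ _ h).1, Finset.mem_coe]
  have hC : cuspSet (deformedBrieskorn p q a b) = T.image Φ := by
    ext c
    rw [cuspSet, Set.mem_ofPred_eq, (hf.fderiv_ne_zero_and_isCuspPoint_iff c).2,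
      isDegenerateCritical_deformedBrieskorn_iff hp hq hap hbq hab, Finset.mem_coe,
      Finset.mem_image]
    constructor
    · intro hc
      obtain ⟨x, ζ, hζ, hx, rfl⟩ := exists_branch_of_isCuspCandidate hp hq hz' hw' hz₀ hw₀ hzw hc
      exact ⟨⟨ζ, x⟩, hT.2 ⟨hζ, hx⟩, rfl⟩
    · rintro ⟨y, hy, rfl⟩
      exact isCuspCandidate_critParam hp hq hz₀ hw₀ (hT.1 hy).1 (hT.1 hy).2
  -- The fibre is a torsor under the `2(q-1)`-th roots of unity: `u` sends `x` to `u x` and forces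
  -- `ζ` to become `u^(-2(p-1)) ζ`.
  have hfib : ∀ c ∈ T.image Φ, (T.filter fun y => Φ y = c).card = 2 * (q - 1) := by
    intro c hc
    obtain ⟨⟨ζ, x⟩, hy, rfl⟩ := Finset.mem_image.1 hc
    obtain ⟨hζ, hx⟩ := hT.1 hy
    dsimp only at hζ hx
    have hx0 : x ≠ 0 := by rintro rfl; simpa using hx.1
    have hζ0 : ζ ≠ 0 := by
      rintro rfl
      rw [zero_pow hq1.ne'] at hζ
      simp at hζ
    have hq2 : 0 < 2 * (q - 1) := by omega
    rw [← (Complex.isPrimitiveRoot_exp (2 * (q - 1)) hq2.ne').card_nthRootsFinset]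
    symm
    refine Finset.card_bij' (fun u _ => (⟨(u ^ (2 * (p - 1)))⁻¹ * ζ, u * x⟩ : Σ _ : ℂ, ℂ))
      (fun y _ => y.2 / x) ?_ ?_ ?_ ?_
    · intro u hu
      rw [Polynomial.mem_nthRootsFinset hq2] at hu
      have hu0 : u ≠ 0 := by
        rintro rfl
        rw [zero_pow hq2.ne'] at hu
        simp at hu
      have hv : ((u ^ (2 * (p - 1)))⁻¹) ^ (q - 1) = 1 := by
        rw [inv_pow, ← pow_mul, show 2 * (p - 1) * (q - 1) = 2 * (q - 1) * (p - 1) by ring,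
          pow_mul, hu, one_pow, inv_one]
      have heq := (critParam_eq_iff hp hq hz' hw' hzw hx0 hζ hv).2
        ⟨hu, inv_mul_cancel₀ (pow_ne_zero _ hu0)⟩
      refine Finset.mem_filter.2 ⟨hT.2 ⟨?_, mul_mem_branchZeros hp hq hu hx heq⟩, heq⟩
      rw [mul_pow, hv, hζ, one_mul]
    · rintro ⟨ζ', x'⟩ hy'
      obtain ⟨hy', heq⟩ := Finset.mem_filter.1 hy'
      have hζ' := (hT.1 hy').1
      rw [Polynomial.mem_nthRootsFinset hq2]
      refine ((critParam_eq_iff hp hq hz' hw' hzw hx0 hζ (v := ζ' / ζ) (u := x' / x)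
        (by rw [div_pow, hζ, div_one]; exact hζ')).1 ?_).1
      rw [div_mul_cancel₀ _ hx0, div_mul_cancel₀ _ hζ0]
      exact heq
    · intro u _
      exact mul_div_cancel_right₀ u hx0
    · rintro ⟨ζ', x'⟩ hy'
      obtain ⟨hy', heq⟩ := Finset.mem_filter.1 hy'
      have hζ' := (hT.1 hy').1
      have := ((critParam_eq_iff hp hq hz' hw' hzw hx0 hζ (v := ζ' / ζ) (u := x' / x)
        (by rw [div_pow, hζ, div_one]; exact hζ')).1 (by
          rw [div_mul_cancel₀ _ hx0, div_mul_cancel₀ _ hζ0]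
          exact heq)).2
      have e1 := eq_inv_of_mul_eq_one_left this
      rw [← e1, div_mul_cancel₀ _ hx0, div_mul_cancel₀ _ hζ0]
  -- Counting `T` by fibres of `Φ` and by branches gives `2(q-1)` times the number of cusps as a sum
  -- of `q-1` terms in `[2m, 2n]`.
  have hcard := Finset.card_eq_sum_card_image Φ T
  rw [Finset.sum_congr rfl hfib, Finset.sum_const, smul_eq_mul, Finset.card_sigma] at hcard
  have hR := (Complex.isPrimitiveRoot_exp (q - 1) hq1.ne').card_nthRootsFinset
  have hlow := Finset.card_nsmul_le_sum (Polynomial.nthRootsFinset (q - 1) (1 : ℂ))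
    (fun ζ => (Z ζ).card) _ fun ζ h => (hZ ζ (hroots.1 h)).2.1
  have hupp := Finset.sum_le_card_nsmul (Polynomial.nthRootsFinset (q - 1) (1 : ℂ))
    (fun ζ => (Z ζ).card) _ fun ζ h => (hZ ζ (hroots.1 h)).2.2
  rw [hR, smul_eq_mul, hcard] at hlow hupp
  rw [hC, Set.ncard_coe_finset]
  have hq2 : 0 < 2 * (q - 1) := by omega
  refine ⟨Finset.finite_toSet _, Nat.le_of_mul_le_mul_right ?_ hq2,
    Nat.le_of_mul_le_mul_right ?_ hq2⟩
  · linarith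
  · linarith

end CuspCount

theorem theorem1p2 (p q : ℕ) (hq : 2 ≤ q) (hpq : q ≤ p) (a b : ℂ)
    (hf : IsExcellentMap (deformedBrieskorn p q a b)) :
    (cuspSet (deformedBrieskorn p q a b)).Finite ∧
    ((cuspSet (deformedBrieskorn p q a b)).ncard : ℤ) ∈
      Set.Icc (((p : ℤ) + 1) * ((q : ℤ) - 1)) (((p : ℤ) - 1) * ((q : ℤ) + 1)) ∧
    (p = q → ((cuspSet (deformedBrieskorn p q a b)).ncard : ℤ) = (p : ℤ) ^ 2 - 1) := by
  obtain ⟨hfin, hlow, hupp⟩ := hf.cuspSet_finite_and_ncard hq hpq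
  zify [show 1 ≤ q by omega, show 1 ≤ p by omega] at hlow hupp
  refine ⟨hfin, ⟨hlow, by linarith⟩, ?_⟩
  rintro rfl
  linarith
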